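/- A closure space is a set $X$ with a map $c:2^X\to 2^X$ such that $c(\varnothing)=\varnothing$, $A\subset c(A)$ and $c(A\cup B)=c(A)\cup c(B)$ for all $A,B\subset X$ (idempotency is not required). A map $f:(X,c)\to(Y,d)$ of closure spaces is continuous if $f(c(A))\subset d(f(A))$ for all $A\subset X$. The interior of $A$ is $i(A)=X\setminus c(X\setminus A)$, and $V$ is a neighborhood of $x$ if $x\in i(V)$. A family $\mathcal U=\{U_j\}_{j\in J}$ of subsets of $X$ with union $X$ is an interior cover if every $x\in X$ has a neighborhood among the $U_j$. Let $|\Delta^n|\subset\mathbb R^{n+1}$ be the standard simplex with its usual topology, regarded as a closure space. For $n\ge 0$ let $C_n(X)$ be the free abelian group on the continuous maps $\sigma:|\Delta^n|\to X$, with boundary $\partial\sigma=\sum_{i=0}^n(-1)^i\sigma|_{[e_0,\dots,\hat e_i,\dots,e_n]}$ for $n\ge 1$, and let $C_n(X)=0$ for $n<0$. Let $C_n^{\mathcal U}(X)\subset C_n(X)$ be the subgroup of the chains $\sum_i n_i\sigma_i$ such that the image of each $\sigma_i$ is contained in some member of $\mathcal U$; these subgroups form a subcomplex. Write $H_n(X)$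 and $H_n^{\mathcal U}(X)$ for the homology groups of the two complexes. **Proposition.** Let $X$ be a closure space and $\mathcal U$ an interior cover of $X$. Then the inclusion $\iota:C_\bullet^{\mathcal U}(X)\to C_\bullet(X)$ is a chain homotopy equivalence. Hence $\iota$ induces isomorphisms $H_n^{\mathcal U}(X)\cong H_n(X)$ for all $n\in\mathbb Z$. -/

import Mathlib

universe u v

/-- A (Čech) closure operator on a set `X`. It need not be idempotent. -/
structure CechClosure (X : Type u) where
  /-- The closure of a subset. -/
  cl : Set X → Set X
  cl_empty : cl ∅ = ∅
  subset_cl : ∀ A, A ⊆ cl A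
  cl_union : ∀ A B, cl (A ∪ B) = cl A ∪ cl B

noncomputable section

namespace CechClosure

/-- The interior operation: the complement of the closure of the complement. -/
def int {X : Type u} (c : CechClosure X) (A : Set X) : Set X := (c.cl Aᶜ)ᶜ

/-- `V` is a neighborhood of the point `x`. -/
def IsNhd {X : Type u} (c : CechClosure X) (V : Set X) (x : X) : Prop := {x} ⊆ c.int V

/-- The topological closure operator of a topological space. -/
def ofTopology (X : Type u) [TopologicalSpace X] : CechClosure X where
  cl := closure
  cl_empty := closure_empty
  subset_cl _ := subset_closure
  cl_union _ _ := closure_union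

/-- Continuity of a map of closure spaces `(X, c) → (Y, d)`. -/
def IsContinuous {X : Type u} {Y : Type v} (c : CechClosure X) (d : CechClosure Y)
    (f : X → Y) : Prop :=
  ∀ A : Set X, f '' c.cl A ⊆ d.cl (f '' A)

/-- `{U j}` is an interior cover: it covers `X` and every point has a neighborhood among
the `U j`. -/
structure IsInteriorCover {X : Type u} (c : CechClosure X) {J : Type v} (U : J → Set X) :
    Prop where
  iUnion_eq : ⋃ j, U j = Set.univ
  exists_isNhd : ∀ x : X, ∃ j, c.IsNhd (U j) x

/-- Singular `n`-simplices of `(X, c)`: continuous maps from the standard `n`-simplex. -/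
def SingularSimplex {X : Type u} (c : CechClosure X) (n : ℕ) : Type u :=
  {σ : stdSimplex ℝ (Fin (n + 1)) → X // (ofTopology (stdSimplex ℝ (Fin (n + 1)))).IsContinuous c σ}

/-- The `i`-th face of a singular simplex: its restriction to `[e₀, …, êᵢ, …, eₙ₊₁]`, which is
identified with the standard `n`-simplex by the order-preserving affine bijection. -/
def SingularSimplex.face {X : Type u} {c : CechClosure X} {n : ℕ} (σ : c.SingularSimplex (n + 1))
    (i : Fin (n + 2)) : c.SingularSimplex n :=
  ⟨fun t => σ.1 (stdSimplex.map i.succAbove t), by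
    intro A
    rintro _ ⟨t, ht, rfl⟩
    have h1 := image_closure_subset_closure_image
      (stdSimplex.continuous_map (S := ℝ) i.succAbove) (Set.mem_image_of_mem _ ht)
    have h2 := σ.2 _ (Set.mem_image_of_mem σ.1 h1)
    rwa [Set.image_image] at h2⟩

/-- Singular `n`-chains: the free abelian group on the singular `n`-simplices. -/
abbrev SingularChain {X : Type u} (c : CechClosure X) (n : ℕ) : Type u :=
  c.SingularSimplex n →₀ ℤ

/-- The boundary map `σ ↦ ∑ᵢ (-1)ⁱ σ|[e₀, …, êᵢ, …, eₙ₊₁]`, extended linearly. -/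
def boundary {X : Type u} (c : CechClosure X) (n : ℕ) :
    c.SingularChain (n + 1) →ₗ[ℤ] c.SingularChain n :=
  Finsupp.linearCombination ℤ fun σ =>
    ∑ i : Fin (n + 2), (-1 : ℤ) ^ (i : ℕ) • Finsupp.single (σ.face i) (1 : ℤ)

theorem boundary_single {X : Type u} (c : CechClosure X) (n : ℕ)
    (σ : c.SingularSimplex (n + 1)) :
    c.boundary n (Finsupp.single σ 1) =
      ∑ i : Fin (n + 2), (-1 : ℤ) ^ (i : ℕ) • Finsupp.single (σ.face i) (1 : ℤ) := by
  simp [boundary]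

theorem face_face {X : Type u} {c : CechClosure X} {n : ℕ} (σ : c.SingularSimplex (n + 2))
    (i j : Fin (n + 2)) (h : i ≤ j) :
    (σ.face j.succ).face i = (σ.face i.castSucc).face j := by
  apply Subtype.ext
  funext t
  simp only [SingularSimplex.face, stdSimplex.map_comp_apply]
  refine congrArg (fun f => σ.1 (stdSimplex.map f t)) ?_
  funext k
  rcases i with ⟨i, _⟩
  rcases j with ⟨j, _⟩
  rcases k with ⟨k, _⟩
  simp only [Fin.le_def, Function.comp_apply, Fin.succAbove, Fin.lt_def, Fin.ext_iff] at *
  split_ifs <;> simp at * <;> lia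

theorem boundary_comp_boundary {X : Type u} (c : CechClosure X) (n : ℕ) :
    c.boundary n ∘ₗ c.boundary (n + 1) = 0 := by
  apply Finsupp.lhom_ext'
  intro σ
  apply LinearMap.ext_ring
  simp only [LinearMap.comp_apply, Finsupp.lsingle_apply, boundary_single, map_sum, map_smul,
    Finset.smul_sum, smul_smul, LinearMap.zero_apply]
  rw [← Finset.sum_product', Finset.univ_product_univ]
  let S : Finset (Fin (n + 3) × Fin (n + 2)) := {ij | (ij.1 : ℕ) ≤ (ij.2 : ℕ)}
  rw [← Finset.sum_add_sum_compl S, ← eq_neg_iff_add_eq_zero, ← Finset.sum_neg_distrib]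
  refine Finset.sum_bij
    (fun ij hij => (ij.2.succ, ij.1.castLT (lt_of_le_of_lt (Finset.mem_filter.mp hij).2 ij.2.2)))
    ?_ ?_ ?_ ?_
  · rintro ⟨i, j⟩ hij
    simp only [S, Finset.mem_filter, Finset.mem_compl, Finset.mem_univ, true_and] at hij ⊢
    simp
    lia
  · rintro ⟨i, j⟩ hij ⟨i', j'⟩ hij' h
    simp only [Prod.mk.injEq, Fin.ext_iff, Fin.val_succ, Fin.val_castLT] at h ⊢
    lia
  · rintro ⟨i', j'⟩ hij'
    simp only [S, Finset.mem_filter, Finset.mem_compl, Finset.mem_univ, true_and, not_le] at hij'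
    refine ⟨(j'.castSucc, i'.pred (by rintro rfl; simp at hij')), ?_, ?_⟩
    · simp only [S, Finset.mem_filter, Finset.mem_univ, true_and, Fin.val_castSucc, Fin.val_pred]
      lia
    · simp
  · rintro ⟨i, j⟩ hij
    simp only [S, Finset.mem_filter, Finset.mem_univ, true_and] at hij
    obtain ⟨i, rfl⟩ : ∃ i' : Fin (n + 2), i'.castSucc = i :=
      ⟨i.castLT (lt_of_le_of_lt hij j.2), by simp⟩
    simp only [Fin.castLT_castSucc, face_face σ i j (by simpa using hij), Fin.val_succ,
      Fin.val_castSucc, ← neg_smul]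
    congr 1
    ring

/-- The singular chain complex `C_•(X)`. -/
def singularChainComplex {X : Type u} (c : CechClosure X) : ChainComplex (ModuleCat.{u} ℤ) ℕ :=
  ChainComplex.of (fun n => ModuleCat.of ℤ (c.SingularChain n))
    (fun n => ModuleCat.ofHom (c.boundary n))
    (fun n => by rw [← ModuleCat.ofHom_comp, boundary_comp_boundary]; rfl)

/-- A singular simplex is small with respect to a family of subsets if its image is contained in
a member of the family. -/
def IsSmall {X : Type u} {c : CechClosure X} {J : Type v} (U : J → Set X) {n : ℕ}
    (σ : c.SingularSimplex n) : Prop :=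
  ∃ j, Set.range σ.1 ⊆ U j

/-- The subgroup of small `n`-chains: the chains in which every simplex that occurs is small. -/
def smallChains {X : Type u} (c : CechClosure X) {J : Type v} (U : J → Set X) (n : ℕ) :
    Submodule ℤ (c.SingularChain n) :=
  Finsupp.supported ℤ ℤ {σ | IsSmall U σ}

theorem boundary_mem_smallChains {X : Type u} (c : CechClosure X) {J : Type v} (U : J → Set X)
    (n : ℕ) (x : c.SingularChain (n + 1)) (hx : x ∈ c.smallChains U (n + 1)) :
    c.boundary n x ∈ c.smallChains U n := by
  rw [boundary, Finsupp.linearCombination_apply, Finsupp.sum]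
  refine Submodule.sum_mem _ fun σ hσ => Submodule.smul_mem _ _ (Submodule.sum_mem _ fun i _ =>
    Submodule.smul_mem _ _ (Finsupp.single_mem_supported ℤ _ ?_))
  obtain ⟨j, hj⟩ := hx hσ
  exact ⟨j, by rintro _ ⟨t, rfl⟩; exact hj ⟨_, rfl⟩⟩

/-- The boundary map restricted to small chains. -/
def smallBoundary {X : Type u} (c : CechClosure X) {J : Type v} (U : J → Set X) (n : ℕ) :
    c.smallChains U (n + 1) →ₗ[ℤ] c.smallChains U n :=
  (c.boundary n).restrict (c.boundary_mem_smallChains U n)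

/-- The complex `C_•^U(X)` of small singular chains. -/
def smallSingularChainComplex {X : Type u} (c : CechClosure X) {J : Type v} (U : J → Set X) :
    ChainComplex (ModuleCat.{u} ℤ) ℕ :=
  ChainComplex.of (fun n => ModuleCat.of ℤ (c.smallChains U n))
    (fun n => ModuleCat.ofHom (c.smallBoundary U n))
    (fun n => by
      apply ModuleCat.hom_ext
      apply LinearMap.ext
      intro x
      exact Subtype.ext (LinearMap.congr_fun (c.boundary_comp_boundary n) x.1))

/-- The inclusion `ι : C_•^U(X) → C_•(X)`. -/
def smallInclusion {X : Type u} (c : CechClosure X) {J : Type v} (U : J → Set X) :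
    c.smallSingularChainComplex U ⟶ c.singularChainComplex :=
  ChainComplex.ofHom (fun n => ModuleCat.ofHom (c.smallChains U n).subtype)
    (fun n => by simp only [smallSingularChainComplex, singularChainComplex, ChainComplex.of_d]; rfl)

/-- The embedding of degrees `ℕ → ℤ`; extending a complex along it puts `0` in all negative
degrees. -/
def natToInt : (ComplexShape.down ℕ).Embedding (ComplexShape.down ℤ) :=
  ComplexShape.Embedding.mk' _ _ (fun n => (n : ℤ)) (fun _ _ h => by simpa using h)
    (by intro i j; simp only [ComplexShape.down_Rel]; lia)

/-- The singular homology group `H_n(X)`, `n ∈ ℤ`. -/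
def singularHomology {X : Type u} (c : CechClosure X) (n : ℤ) : ModuleCat.{u} ℤ :=
  (c.singularChainComplex.extend natToInt).homology n

/-- The homology group `H_n^U(X)` of small singular chains, `n ∈ ℤ`. -/
def smallSingularHomology {X : Type u} (c : CechClosure X) {J : Type v} (U : J → Set X) (n : ℤ) :
    ModuleCat.{u} ℤ :=
  ((c.smallSingularChainComplex U).extend natToInt).homology n

/-- The map `H_n^U(X) → H_n(X)` induced by the inclusion of small chains. -/
def smallHomologyMap {X : Type u} (c : CechClosure X) {J : Type v} (U : J → Set X) (n : ℤ) :
    c.smallSingularHomology U n ⟶ c.singularHomology n :=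
  HomologicalComplex.homologyMap
    (HomologicalComplex.extendMap (c.smallInclusion U) natToInt) n

end CechClosure

end

noncomputable section

/-! Write S for barycentric subdivision, T for a natural homotopy with ∂T + T∂ = 1 - S, and D_m =
∑_{i<m} T S^i, so that ∂D_m + D_m∂ = 1 - S^m. Closure spaces enter only through a Lebesgue number:
since |Δⁿ| is a topological space, a continuous σ pulls an interior cover back to sets whose
topological interiors cover the compact simplex, so some S^k σ is small
(`IsInteriorCover.exists_iterate_subdivision_mem`). Idempotency of the closure plays no role.

The number of subdivisions depends on σ. Choose m(σ) with S^{m(σ)} σ small, m(face) ≤ m(σ), and m =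
0 on small simplices, and put Dσ = D_{m(σ)} σ. Then σ - (∂D + D∂)σ = S^{m(σ)} σ + (D_{m(σ)} - D)∂σ,
and the last term is small because it only involves T S^i of faces τ with i ≥ m(τ)
(`IsInteriorCover.sub_smallHomotopy_mem`). Hence ρ = 1 - (∂D + D∂) is a chain map into small chains,
homotopic to the identity, and exactly the identity on small chains.

S and T are built on formal tuples of points by coning, then carried to singular chains by
naturality. -/

theorem Finsupp.map_mem_supported {α β : Type*} {s : Set α} {t : Set β}
    (f : (α →₀ ℤ) →ₗ[ℤ] (β →₀ ℤ))
    (h : ∀ a ∈ s, f (Finsupp.single a 1) ∈ Finsupp.supported ℤ ℤ t) {x : α →₀ ℤ}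
    (hx : x ∈ Finsupp.supported ℤ ℤ s) : f x ∈ Finsupp.supported ℤ ℤ t := by
  have : Finsupp.supported ℤ ℤ s ≤ (Finsupp.supported ℤ ℤ t).comap f := by
    rw [Finsupp.supported_eq_span_single, Submodule.span_le]
    rintro _ ⟨a, ha, rfl⟩
    exact h a ha
  exact this hx

/-! ### Formal subdivision and its homotopy on tuples; length `n` means dimension `n - 1`. -/

/-- The free abelian group on the `n`-tuples in `V`. -/
abbrev OrderedChain (V : Type*) (n : ℕ) : Type _ := (Fin n → V) →₀ ℤ

namespace OrderedChain

variable {V W : Type*}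

/-- The alternating sum of the faces of a tuple, with the empty tuple as augmentation. -/
def boundary (n : ℕ) : OrderedChain V (n + 1) →ₗ[ℤ] OrderedChain V n :=
  Finsupp.linearCombination ℤ fun w =>
    ∑ i : Fin (n + 1), (-1 : ℤ) ^ (i : ℕ) • Finsupp.single (w ∘ i.succAbove) (1 : ℤ)

theorem boundary_single {n : ℕ} (w : Fin (n + 1) → V) :
    boundary n (Finsupp.single w 1) =
      ∑ i : Fin (n + 1), (-1 : ℤ) ^ (i : ℕ) • Finsupp.single (w ∘ i.succAbove) (1 : ℤ) := by
  simp [boundary]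

/-- The cone with apex `a`. -/
def cone (a : V) (n : ℕ) : OrderedChain V n →ₗ[ℤ] OrderedChain V (n + 1) :=
  Finsupp.lmapDomain ℤ ℤ fun w => (Fin.cons a w : Fin (n + 1) → V)

theorem cone_single (a : V) {n : ℕ} (w : Fin n → V) :
    cone a n (Finsupp.single w 1) = Finsupp.single (Fin.cons a w : Fin (n + 1) → V) 1 := by
  simp [cone]

/-- The map on chains induced by a map of vertices. -/
def map (f : V → W) (n : ℕ) : OrderedChain V n →ₗ[ℤ] OrderedChain W n :=
  Finsupp.lmapDomain ℤ ℤ fun w => f ∘ w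

theorem map_single (f : V → W) {n : ℕ} (w : Fin n → V) :
    map f n (Finsupp.single w 1) = Finsupp.single (f ∘ w) 1 := by
  simp [map]

theorem boundary_cone_zero (a : V) (x : OrderedChain V 0) : boundary 0 (cone a 0 x) = x := by
  suffices boundary 0 ∘ₗ cone a 0 = LinearMap.id from LinearMap.congr_fun this x
  ext1 w
  apply LinearMap.ext_ring
  simp only [LinearMap.comp_apply, Finsupp.lsingle_apply, cone_single, boundary_single,
    LinearMap.id_apply]
  rw [Fin.sum_univ_succ, Fin.sum_univ_zero, Fin.val_zero, pow_zero, one_smul, add_zero]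
  congr 1

theorem boundary_cone_succ (a : V) {n : ℕ} (x : OrderedChain V (n + 1)) :
    boundary (n + 1) (cone a (n + 1) x) = x - cone a n (boundary n x) := by
  suffices boundary (n + 1) ∘ₗ cone a (n + 1) = LinearMap.id - cone a n ∘ₗ boundary n from
    LinearMap.congr_fun this x
  ext1 w
  apply LinearMap.ext_ring
  simp only [LinearMap.comp_apply, Finsupp.lsingle_apply, cone_single, boundary_single,
    LinearMap.id_apply, LinearMap.sub_apply, map_sum, map_smul]
  rw [Fin.sum_univ_succ, sub_eq_add_neg, ← Finset.sum_neg_distrib]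
  congr 1
  · simp only [Fin.val_zero, pow_zero, one_smul]
    congr 1
  · refine Finset.sum_congr rfl fun i _ => ?_
    rw [Fin.val_succ, pow_succ, mul_neg_one, neg_smul]
    congr 3
    funext k
    refine Fin.cases ?_ (fun k => ?_) k <;> simp

/-- Every nonempty tuple is a cone over its tail, so the cone formula gives ∂∂(cone y) = cone(∂∂y)
and induction replaces the usual cancellation of signs. -/
theorem boundary_boundary {n : ℕ} (x : OrderedChain V (n + 2)) :
    boundary n (boundary (n + 1) x) = 0 := by
  suffices boundary n ∘ₗ boundary (n + 1) = (0 : OrderedChain V (n + 2) →ₗ[ℤ] _) from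
    LinearMap.congr_fun this x
  induction n with
  | zero =>
    ext1 w
    apply LinearMap.ext_ring
    obtain ⟨a, w, rfl⟩ : ∃ a w', w = (Fin.cons a w' : Fin 2 → V) := ⟨_, _, (Fin.cons_self_tail w).symm⟩
    simp only [LinearMap.comp_apply, Finsupp.lsingle_apply, ← cone_single, boundary_cone_succ,
      map_sub, boundary_cone_zero, sub_self, LinearMap.zero_apply]
  | succ n ih =>
    ext1 w
    apply LinearMap.ext_ring
    obtain ⟨a, w, rfl⟩ : ∃ a w', w = (Fin.cons a w' : Fin (n + 3) → V) :=
      ⟨_, _, (Fin.cons_self_tail w).symm⟩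
    have h : boundary n (boundary (n + 1) (Finsupp.single w 1)) = 0 :=
      LinearMap.congr_fun (ih (Finsupp.single w 1)) _
    simp only [LinearMap.comp_apply, Finsupp.lsingle_apply, ← cone_single, boundary_cone_succ,
      map_sub, sub_self, LinearMap.zero_apply, h, map_zero, sub_zero]

theorem map_boundary (f : V → W) {n : ℕ} (x : OrderedChain V (n + 1)) :
    map f n (boundary n x) = boundary n (map f (n + 1) x) := by
  suffices map f n ∘ₗ boundary n = boundary n ∘ₗ map f (n + 1) from LinearMap.congr_fun this x
  ext1 w
  apply LinearMap.ext_ring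
  simp only [LinearMap.comp_apply, Finsupp.lsingle_apply, map_single, boundary_single, map_sum,
    map_smul, Function.comp_assoc]

theorem map_cone (f : V → W) (a : V) {n : ℕ} (x : OrderedChain V n) :
    map f (n + 1) (cone a n x) = cone (f a) n (map f n x) := by
  suffices map f (n + 1) ∘ₗ cone a n = cone (f a) n ∘ₗ map f n from LinearMap.congr_fun this x
  ext1 w
  apply LinearMap.ext_ring
  simp only [LinearMap.comp_apply, Finsupp.lsingle_apply, map_single, cone_single, Fin.comp_cons]

/-- The subdivision operator that cones off from a chosen centre `b w` of every tuple `w`. -/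
def subdivision (b : ∀ n, (Fin (n + 1) → V) → V) : ∀ n, OrderedChain V n →ₗ[ℤ] OrderedChain V n
  | 0 => LinearMap.id
  | n + 1 => Finsupp.linearCombination ℤ fun w =>
      cone (b n w) n (subdivision b n (boundary n (Finsupp.single w 1)))

/-- The chain homotopy between the subdivision operator and the identity. -/
def homotopy (b : ∀ n, (Fin (n + 1) → V) → V) :
    ∀ n, OrderedChain V n →ₗ[ℤ] OrderedChain V (n + 1)
  | 0 => 0
  | n + 1 => Finsupp.linearCombination ℤ fun w =>
      cone (b n w) (n + 1)
        (Finsupp.single w 1 - homotopy b n (boundary n (Finsupp.single w 1)))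

section

variable (b : ∀ n, (Fin (n + 1) → V) → V)

theorem subdivision_single {n : ℕ} (w : Fin (n + 1) → V) :
    subdivision b (n + 1) (Finsupp.single w 1) =
      cone (b n w) n (subdivision b n (boundary n (Finsupp.single w 1))) := by
  simp [subdivision]

theorem homotopy_single {n : ℕ} (w : Fin (n + 1) → V) :
    homotopy b (n + 1) (Finsupp.single w 1) =
      cone (b n w) (n + 1)
        (Finsupp.single w 1 - homotopy b n (boundary n (Finsupp.single w 1))) := by
  simp [homotopy]

/-- ∂ of the cone over S∂w is S∂w minus the cone over ∂S∂w, and ∂S∂w = S∂∂w = 0 by induction. -/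
theorem boundary_subdivision {n : ℕ} (x : OrderedChain V (n + 1)) :
    boundary n (subdivision b (n + 1) x) = subdivision b n (boundary n x) := by
  suffices boundary n ∘ₗ subdivision b (n + 1) = subdivision b n ∘ₗ boundary n from
    LinearMap.congr_fun this x
  induction n with
  | zero =>
    ext1 w
    apply LinearMap.ext_ring
    simp only [LinearMap.comp_apply, Finsupp.lsingle_apply, subdivision_single, boundary_cone_zero]
  | succ n ih =>
    ext1 w
    apply LinearMap.ext_ring
    have h := LinearMap.congr_fun (ih (boundary (n + 1) (Finsupp.single w 1)))
      (boundary (n + 1) (Finsupp.single w 1))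
    simp only [LinearMap.comp_apply, boundary_boundary, map_zero] at h
    simp only [LinearMap.comp_apply, Finsupp.lsingle_apply, subdivision_single,
      boundary_cone_succ, h, map_zero, sub_zero]

/-- The cone formula gives ∂Tw = w - T∂w - cone(∂w - ∂T∂w). By induction applied to ∂w the bracket
is S∂w, whose cone is Sw. -/
theorem boundary_homotopy {n : ℕ} (x : OrderedChain V (n + 1)) :
    boundary (n + 1) (homotopy b (n + 1) x) + homotopy b n (boundary n x) =
      x - subdivision b (n + 1) x := by
  suffices boundary (n + 1) ∘ₗ homotopy b (n + 1) + homotopy b n ∘ₗ boundary n =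
      LinearMap.id - subdivision b (n + 1) from LinearMap.congr_fun this x
  induction n with
  | zero =>
    ext1 w
    apply LinearMap.ext_ring
    simp only [LinearMap.comp_apply, LinearMap.add_apply, LinearMap.sub_apply, LinearMap.id_apply,
      Finsupp.lsingle_apply, subdivision_single, homotopy_single, boundary_cone_succ]
    simp [homotopy, subdivision]
  | succ n ih =>
    ext1 w
    apply LinearMap.ext_ring
    have h := LinearMap.congr_fun (ih (boundary (n + 1) (Finsupp.single w 1)))
      (boundary (n + 1) (Finsupp.single w 1))
    simp only [LinearMap.comp_apply, LinearMap.add_apply, LinearMap.sub_apply, LinearMap.id_apply,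
      boundary_boundary, map_zero, add_zero] at h
    simp only [LinearMap.comp_apply, LinearMap.add_apply, LinearMap.sub_apply, LinearMap.id_apply,
      Finsupp.lsingle_apply, subdivision_single, homotopy_single, boundary_cone_succ, map_sub, h]
    abel

variable {b} {b' : ∀ n, (Fin (n + 1) → W) → W} {f : V → W}

theorem map_subdivision (hf : ∀ n w, f (b n w) = b' n (f ∘ w)) {n : ℕ} (x : OrderedChain V n) :
    map f n (subdivision b n x) = subdivision b' n (map f n x) := by
  suffices map f n ∘ₗ subdivision b n = subdivision b' n ∘ₗ map f n from LinearMap.congr_fun this x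
  induction n with
  | zero => rfl
  | succ n ih =>
    ext1 w
    apply LinearMap.ext_ring
    have h := LinearMap.congr_fun (ih (boundary n (Finsupp.single w 1)))
      (boundary n (Finsupp.single w 1))
    simp only [LinearMap.comp_apply, map_boundary, map_single] at h
    simp only [LinearMap.comp_apply, Finsupp.lsingle_apply, subdivision_single, map_cone, h,
      map_single, hf]

theorem map_homotopy (hf : ∀ n w, f (b n w) = b' n (f ∘ w)) {n : ℕ} (x : OrderedChain V n) :
    map f (n + 1) (homotopy b n x) = homotopy b' n (map f n x) := by
  suffices map f (n + 1) ∘ₗ homotopy b n = homotopy b' n ∘ₗ map f n from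
    LinearMap.congr_fun this x
  induction n with
  | zero => simp [homotopy]
  | succ n ih =>
    ext1 w
    apply LinearMap.ext_ring
    have h := LinearMap.congr_fun (ih (boundary n (Finsupp.single w 1)))
      (boundary n (Finsupp.single w 1))
    simp only [LinearMap.comp_apply, map_boundary, map_single] at h
    simp only [LinearMap.comp_apply, Finsupp.lsingle_apply, homotopy_single, map_cone, map_sub, h,
      map_single, hf]

end

/-- Subdivision does not leave balls, and it shrinks the mutual distances of the vertices, as soon
as this holds for the chosen centres. -/
theorem subdivision_mem_supported [PseudoMetricSpace V] {b : ∀ n, (Fin (n + 1) → V) → V} {N : ℕ}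
    {r : ℝ} (hb : ∀ n w p d, (∀ i, dist (w i) p ≤ d) → dist (b n w) p ≤ d)
    (hr : ∀ n ≤ N, ∀ w d, (∀ i j, dist (w i) (w j) ≤ d) → ∀ i, dist (w i) (b n w) ≤ r * d)
    {n : ℕ} (hn : n ≤ N + 1) (w : Fin n → V) :
    subdivision b n (Finsupp.single w 1) ∈ Finsupp.supported ℤ ℤ
      {v | (∀ p d, (∀ i, dist (w i) p ≤ d) → ∀ i, dist (v i) p ≤ d) ∧
        ∀ d, (∀ i j, dist (w i) (w j) ≤ d) → ∀ i j, dist (v i) (v j) ≤ r * d} := by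
  induction n with
  | zero => exact Finsupp.single_mem_supported ℤ _ ⟨fun _ _ h => h, fun _ _ i => i.elim0⟩
  | succ n ih =>
    rw [subdivision_single, boundary_single, map_sum, map_sum]
    refine Submodule.sum_mem _ fun i _ => ?_
    rw [map_smul, map_smul]
    refine Submodule.smul_mem _ _ (Finsupp.map_mem_supported (cone (b n w) n) ?_
      (ih (by lia) (w ∘ i.succAbove)))
    rintro v ⟨hv₁, hv₂⟩
    rw [cone_single]
    refine Finsupp.single_mem_supported ℤ _ ⟨fun p d h k => ?_, fun d h k l => ?_⟩
    · refine Fin.cases ?_ (fun k => ?_) k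
      · exact hb n w p d h
      · exact hv₁ p d (fun _ => h _) k
    -- The ball clause, applied to the ball of radius `r * d` about the new apex, bounds the
    -- distance from the apex to all vertices of the subdivided face.
    · have h₁ (k) : dist (v k) (b n w) ≤ r * d :=
        hv₁ _ _ (fun i => hr n (by lia) w d h _) k
      have h₂ := hv₂ d fun _ _ => h _ _
      have h₃ : 0 ≤ r * d := dist_nonneg.trans (hr n (by lia) w d h 0)
      refine Fin.cases (Fin.cases ?_ (fun l => ?_) l) (fun k => Fin.cases ?_ (fun l => ?_) l) k
      · simpa using h₃
      · simpa [dist_comm] using h₁ l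
      · exact h₁ k
      · exact h₂ k l

end OrderedChain

end

/-! ### Affine simplices, barycentres and the mesh of iterated subdivisions. -/

noncomputable section

namespace stdSimplex

variable {k m n : ℕ}

/-- The affine map between standard simplices with prescribed values at the vertices. -/
def affine (w : Fin (m + 1) → stdSimplex ℝ (Fin (n + 1))) (t : stdSimplex ℝ (Fin (m + 1))) :
    stdSimplex ℝ (Fin (n + 1)) :=
  ⟨∑ i, t i • (w i).1, (convex_stdSimplex ℝ _).sum_mem (fun i _ => t.2.1 i) t.2.2
    fun i _ => (w i).2⟩

theorem affine_val (w : Fin (m + 1) → stdSimplex ℝ (Fin (n + 1)))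
    (t : stdSimplex ℝ (Fin (m + 1))) : (affine w t).1 = ∑ i, t i • (w i).1 := rfl

theorem continuous_affine (w : Fin (m + 1) → stdSimplex ℝ (Fin (n + 1))) :
    Continuous (affine w) :=
  Continuous.subtype_mk (continuous_finsetSum _ fun i _ =>
    ((continuous_apply i).comp continuous_subtype_val).smul continuous_const) _

theorem affine_affine (w : Fin (m + 1) → stdSimplex ℝ (Fin (n + 1)))
    (v : Fin (k + 1) → stdSimplex ℝ (Fin (m + 1))) (t : stdSimplex ℝ (Fin (k + 1))) :
    affine w (affine v t) = affine (affine w ∘ v) t := by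
  apply Subtype.ext
  simp only [affine_val, Function.comp_apply, Finset.smul_sum, smul_smul]
  rw [Finset.sum_comm]
  refine Finset.sum_congr rfl fun i _ => ?_
  rw [← Finset.sum_smul]
  congr 1
  change (affine v t).1 i = _
  simp only [affine_val, Finset.sum_apply, Pi.smul_apply, smul_eq_mul]
  rfl

theorem affine_vertex (w : Fin (m + 1) → stdSimplex ℝ (Fin (n + 1))) :
    affine w ∘ vertex = w := by
  funext i
  apply Subtype.ext
  simp [affine_val, Pi.single_apply]

theorem affine_comp_vertex (f : Fin (m + 1) → Fin (n + 1)) (t : stdSimplex ℝ (Fin (m + 1))) :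
    affine (fun i => vertex (f i)) t = map f t := by
  ext j
  rw [map_coe, FunOnFinite.linearMap_apply_apply]
  change (affine (fun i => vertex (f i)) t).1 j = _
  simp [affine_val, Finset.sum_filter, Pi.single_apply, eq_comm]

theorem affine_map (w : Fin (n + 1) → stdSimplex ℝ (Fin (k + 1))) (f : Fin (m + 1) → Fin (n + 1))
    (t : stdSimplex ℝ (Fin (m + 1))) : affine w (map f t) = affine (w ∘ f) t := by
  rw [← affine_comp_vertex, affine_affine]
  congr 1
  exact funext fun i => congrFun (affine_vertex w) (f i)

theorem affine_vertex_id (t : stdSimplex ℝ (Fin (n + 1))) : affine vertex t = t := by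
  simpa using affine_comp_vertex (id : Fin (n + 1) → Fin (n + 1)) t

theorem dist_affine_le {w : Fin (m + 1) → stdSimplex ℝ (Fin (n + 1))}
    {p : stdSimplex ℝ (Fin (n + 1))} {d : ℝ} (h : ∀ i, dist (w i) p ≤ d)
    (t : stdSimplex ℝ (Fin (m + 1))) : dist (affine w t) p ≤ d :=
  (convex_closedBall p.1 d).sum_mem (fun i _ => t.2.1 i) t.2.2 fun i _ => h i

/-- The barycentre of a tuple of points of a standard simplex. -/
def centre (m : ℕ) (w : Fin (m + 1) → stdSimplex ℝ (Fin (n + 1))) : stdSimplex ℝ (Fin (n + 1)) :=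
  affine w barycenter

/-- In the average of the differences w_j - w_i the term j = i vanishes, leaving m terms of weight
1/(m+1). The bound is weakened to N/(N+1) so that one ratio serves all faces. -/
theorem dist_centre_le {N : ℕ} (hm : m ≤ N) {w : Fin (m + 1) → stdSimplex ℝ (Fin (n + 1))} {d : ℝ}
    (h : ∀ i j, dist (w i) (w j) ≤ d) (i : Fin (m + 1)) :
    dist (w i) (centre m w) ≤ N / (N + 1) * d := by
  have hd : 0 ≤ d := dist_nonneg.trans (h 0 0)
  have key : (centre m w).1 - (w i).1 = ∑ j, ((m : ℝ) + 1)⁻¹ • ((w j).1 - (w i).1) := by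
    have h₁ : (centre m w).1 = ∑ j, ((m : ℝ) + 1)⁻¹ • (w j).1 := by
      rw [centre, affine_val]
      refine Finset.sum_congr rfl fun j _ => congrArg (fun a : ℝ => a • (w j).1) ?_
      exact (barycenter_apply j).trans (by simp)
    simp only [smul_sub, Finset.sum_sub_distrib, ← h₁, Finset.sum_const, Finset.card_univ,
      Fintype.card_fin]
    rw [← Nat.cast_smul_eq_nsmul ℝ, smul_smul, Nat.cast_succ, mul_inv_cancel₀ (by positivity),
      one_smul]
  rw [dist_comm, Subtype.dist_eq, dist_eq_norm, key, Fin.sum_univ_succAbove _ i, sub_self,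
    smul_zero, zero_add]
  calc _ ≤ ∑ _j : Fin m, ((m : ℝ) + 1)⁻¹ * d := by
        refine norm_sum_le_of_le _ fun j _ => ?_
        rw [norm_smul, Real.norm_of_nonneg (by positivity), ← dist_eq_norm, ← Subtype.dist_eq]
        exact mul_le_mul_of_nonneg_left (h _ _) (by positivity)
    _ = m / (m + 1) * d := by
        simp only [Finset.sum_const, Finset.card_univ, Fintype.card_fin, nsmul_eq_mul]
        ring
    _ ≤ _ := by
        refine mul_le_mul_of_nonneg_right ?_ hd
        have : (m : ℝ) ≤ N := by exact_mod_cast hm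
        rw [div_le_div_iff₀ (by positivity) (by positivity)]
        linarith

end stdSimplex

namespace OrderedChain

open stdSimplex

theorem iterate_subdivision_mem_supported (n k : ℕ) :
    (subdivision centre (n + 1) ^ k) (Finsupp.single vertex 1) ∈ Finsupp.supported ℤ ℤ
      {v : Fin (n + 1) → stdSimplex ℝ (Fin (n + 1)) |
        ∀ i j, dist (v i) (v j) ≤ ((n : ℝ) / (n + 1)) ^ k} := by
  induction k with
  | zero =>
    refine Finsupp.single_mem_supported ℤ _ fun i j => ?_
    rw [pow_zero]
    -- In the sup metric the standard simplex has diameter at most 1, so no constant precedes the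
    -- power.
    exact (Metric.dist_le_diam_of_mem (bounded_stdSimplex _) (vertex i).2 (vertex j).2).trans
      diam_stdSimplex_le
  | succ k ih =>
    rw [pow_succ' (subdivision _ _), Module.End.mul_apply]
    refine Finsupp.map_mem_supported _ (fun w hw => ?_) ih
    refine Finsupp.supported_mono ?_ (subdivision_mem_supported (N := n)
      (fun _ _ _ _ h => dist_affine_le h _) (fun _ hm _ _ h => dist_centre_le hm h) le_rfl w)
    rintro v ⟨-, hv⟩
    rw [Set.mem_ofPred_eq, pow_succ']
    exact hv _ hw

end OrderedChain

/-! ### Subdivision of singular chains and the Lebesgue number argument. -/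

namespace CechClosure

open stdSimplex

variable {X : Type u} {c : CechClosure X} {J : Type v} {U : J → Set X} {m n : ℕ}

theorem cl_mono (c : CechClosure X) {A B : Set X} (h : A ⊆ B) : c.cl A ⊆ c.cl B := by
  rw [← Set.union_eq_self_of_subset_left h, c.cl_union]
  exact Set.subset_union_left

/-- The precomposition of a singular simplex with an affine map of standard simplices. -/
def SingularSimplex.compAffine (σ : c.SingularSimplex n)
    (w : Fin (m + 1) → stdSimplex ℝ (Fin (n + 1))) : c.SingularSimplex m :=
  ⟨fun t => σ.1 (affine w t), by
    rintro A _ ⟨t, ht, rfl⟩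
    have h₁ := image_closure_subset_closure_image (continuous_affine w)
      (Set.mem_image_of_mem _ ht)
    have h₂ := σ.2 _ (Set.mem_image_of_mem σ.1 h₁)
    rwa [Set.image_image] at h₂⟩

theorem SingularSimplex.compAffine_vertex (σ : c.SingularSimplex n) : σ.compAffine vertex = σ :=
  Subtype.ext (funext fun t => congrArg σ.1 (affine_vertex_id t))

theorem SingularSimplex.face_compAffine (σ : c.SingularSimplex n)
    (w : Fin (m + 2) → stdSimplex ℝ (Fin (n + 1))) (i : Fin (m + 2)) :
    (σ.compAffine w).face i = σ.compAffine (w ∘ i.succAbove) :=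
  Subtype.ext (funext fun t => congrArg σ.1 (affine_map w i.succAbove t))

/-- The chain map from tuples of points of the standard simplex to singular chains that is given
by a singular simplex. -/
def push (σ : c.SingularSimplex n) (m : ℕ) :
    OrderedChain (stdSimplex ℝ (Fin (n + 1))) (m + 1) →ₗ[ℤ] c.SingularChain m :=
  Finsupp.lmapDomain ℤ ℤ fun w => σ.compAffine w

theorem push_single (σ : c.SingularSimplex n) (w : Fin (m + 1) → stdSimplex ℝ (Fin (n + 1))) :
    push σ m (Finsupp.single w 1) = Finsupp.single (σ.compAffine w) 1 := by
  simp [push]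

theorem push_single_vertex (σ : c.SingularSimplex n) :
    push σ n (Finsupp.single vertex 1) = Finsupp.single σ 1 := by
  rw [push_single, σ.compAffine_vertex]

theorem boundary_push (σ : c.SingularSimplex n)
    (x : OrderedChain (stdSimplex ℝ (Fin (n + 1))) (m + 2)) :
    c.boundary m (push σ (m + 1) x) = push σ m (OrderedChain.boundary (m + 1) x) := by
  suffices c.boundary m ∘ₗ push σ (m + 1) = push σ m ∘ₗ OrderedChain.boundary (m + 1) from
    LinearMap.congr_fun this x
  ext1 w
  apply LinearMap.ext_ring
  simp only [LinearMap.comp_apply, Finsupp.lsingle_apply, push_single, boundary_single,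
    OrderedChain.boundary_single, map_sum, map_smul, SingularSimplex.face_compAffine]

theorem push_compAffine {k : ℕ} (σ : c.SingularSimplex n)
    (w : Fin (m + 1) → stdSimplex ℝ (Fin (n + 1)))
    (x : OrderedChain (stdSimplex ℝ (Fin (m + 1))) (k + 1)) :
    push (σ.compAffine w) k x = push σ k (OrderedChain.map (affine w) (k + 1) x) := by
  suffices push (σ.compAffine w) k = push σ k ∘ₗ OrderedChain.map (affine w) (k + 1) from
    LinearMap.congr_fun this x
  ext1 v
  apply LinearMap.ext_ring
  simp only [LinearMap.comp_apply, Finsupp.lsingle_apply, push_single, OrderedChain.map_single]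
  congr 1
  exact Subtype.ext (funext fun t => congrArg σ.1 (affine_affine w v t))

theorem push_mem_smallChains {σ : c.SingularSimplex n} (hσ : IsSmall U σ)
    (x : OrderedChain (stdSimplex ℝ (Fin (n + 1))) (m + 1)) : push σ m x ∈ c.smallChains U m := by
  refine Finsupp.map_mem_supported (s := Set.univ) _ (fun w _ => ?_) (by simp)
  obtain ⟨j, hj⟩ := hσ
  rw [push_single]
  refine Finsupp.single_mem_supported ℤ _ ⟨j, ?_⟩
  rintro _ ⟨t, rfl⟩
  exact hj ⟨_, rfl⟩

variable (c) in
/-- Barycentric subdivision of singular chains. -/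
def subdivision (n : ℕ) : c.SingularChain n →ₗ[ℤ] c.SingularChain n :=
  Finsupp.linearCombination ℤ fun σ =>
    push σ n (OrderedChain.subdivision centre (n + 1) (Finsupp.single vertex 1))

variable (c) in
/-- The chain homotopy between barycentric subdivision and the identity. -/
def subdivisionHomotopy (n : ℕ) : c.SingularChain n →ₗ[ℤ] c.SingularChain (n + 1) :=
  Finsupp.linearCombination ℤ fun σ =>
    push σ (n + 1) (OrderedChain.homotopy centre (n + 1) (Finsupp.single vertex 1))

/-- Affine maps carry barycentres to barycentres, so subdividing commutes with them. With
`push_single_vertex`, this reduces identities for singular chains to identities for tuples. -/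
theorem subdivision_push (σ : c.SingularSimplex n)
    (x : OrderedChain (stdSimplex ℝ (Fin (n + 1))) (m + 1)) :
    c.subdivision m (push σ m x) = push σ m (OrderedChain.subdivision centre (m + 1) x) := by
  suffices c.subdivision m ∘ₗ push σ m = push σ m ∘ₗ OrderedChain.subdivision centre (m + 1) from
    LinearMap.congr_fun this x
  ext1 w
  apply LinearMap.ext_ring
  simp only [LinearMap.comp_apply, Finsupp.lsingle_apply, push_single, subdivision,
    Finsupp.linearCombination_single, one_smul, push_compAffine]
  rw [OrderedChain.map_subdivision (b := centre) (b' := centre) fun _ v => affine_affine w v _,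
    OrderedChain.map_single, affine_vertex]

theorem subdivisionHomotopy_push (σ : c.SingularSimplex n)
    (x : OrderedChain (stdSimplex ℝ (Fin (n + 1))) (m + 1)) :
    c.subdivisionHomotopy m (push σ m x) =
      push σ (m + 1) (OrderedChain.homotopy centre (m + 1) x) := by
  suffices c.subdivisionHomotopy m ∘ₗ push σ m =
      push σ (m + 1) ∘ₗ OrderedChain.homotopy centre (m + 1) from LinearMap.congr_fun this x
  ext1 w
  apply LinearMap.ext_ring
  simp only [LinearMap.comp_apply, Finsupp.lsingle_apply, push_single, subdivisionHomotopy,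
    Finsupp.linearCombination_single, one_smul, push_compAffine]
  rw [OrderedChain.map_homotopy (b := centre) (b' := centre) fun _ v => affine_affine w v _,
    OrderedChain.map_single, affine_vertex]

theorem boundary_subdivision (x : c.SingularChain (n + 1)) :
    c.boundary n (c.subdivision (n + 1) x) = c.subdivision n (c.boundary n x) := by
  suffices c.boundary n ∘ₗ c.subdivision (n + 1) = c.subdivision n ∘ₗ c.boundary n from
    LinearMap.congr_fun this x
  ext1 σ
  apply LinearMap.ext_ring
  simp only [LinearMap.comp_apply, Finsupp.lsingle_apply, ← push_single_vertex σ,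
    subdivision_push, boundary_push, OrderedChain.boundary_subdivision]

theorem boundary_subdivisionHomotopy (x : c.SingularChain (n + 1)) :
    c.boundary (n + 1) (c.subdivisionHomotopy (n + 1) x) +
      c.subdivisionHomotopy n (c.boundary n x) = x - c.subdivision (n + 1) x := by
  suffices c.boundary (n + 1) ∘ₗ c.subdivisionHomotopy (n + 1) +
      c.subdivisionHomotopy n ∘ₗ c.boundary n = LinearMap.id - c.subdivision (n + 1) from
    LinearMap.congr_fun this x
  ext1 σ
  apply LinearMap.ext_ring
  simp only [LinearMap.comp_apply, LinearMap.add_apply, LinearMap.sub_apply, LinearMap.id_apply,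
    Finsupp.lsingle_apply, ← push_single_vertex σ, subdivision_push, subdivisionHomotopy_push,
    boundary_push]
  rw [← map_add, OrderedChain.boundary_homotopy, map_sub]

theorem boundary_subdivisionHomotopy_zero (x : c.SingularChain 0) :
    c.boundary 0 (c.subdivisionHomotopy 0 x) = x - c.subdivision 0 x := by
  suffices c.boundary 0 ∘ₗ c.subdivisionHomotopy 0 = LinearMap.id - c.subdivision 0 from
    LinearMap.congr_fun this x
  ext1 σ
  apply LinearMap.ext_ring
  simp only [LinearMap.comp_apply, LinearMap.sub_apply, LinearMap.id_apply,
    Finsupp.lsingle_apply, ← push_single_vertex σ, subdivision_push, subdivisionHomotopy_push,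
    boundary_push]
  -- The extra summand T∂ factors through the empty tuple, where the homotopy is zero.
  rw [← map_sub, ← OrderedChain.boundary_homotopy]
  simp [OrderedChain.homotopy]

theorem subdivision_mem_smallChains {x : c.SingularChain n} (hx : x ∈ c.smallChains U n) :
    c.subdivision n x ∈ c.smallChains U n := by
  refine Finsupp.map_mem_supported _ (fun σ hσ => ?_) hx
  rw [← push_single_vertex, subdivision_push]
  exact push_mem_smallChains hσ _

theorem subdivisionHomotopy_mem_smallChains {x : c.SingularChain n}
    (hx : x ∈ c.smallChains U n) : c.subdivisionHomotopy n x ∈ c.smallChains U (n + 1) := by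
  refine Finsupp.map_mem_supported _ (fun σ hσ => ?_) hx
  rw [← push_single_vertex, subdivisionHomotopy_push]
  exact push_mem_smallChains hσ _

theorem iterate_subdivision_push (σ : c.SingularSimplex n) (k : ℕ)
    (x : OrderedChain (stdSimplex ℝ (Fin (n + 1))) (m + 1)) :
    (c.subdivision m ^ k) (push σ m x) =
      push σ m ((OrderedChain.subdivision centre (m + 1) ^ k) x) := by
  induction k with
  | zero => rfl
  | succ k ih => rw [pow_succ', pow_succ', Module.End.mul_apply, ih, subdivision_push,
      Module.End.mul_apply]

/-- The preimages of an interior cover under a singular simplex have a Lebesgue number. -/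
theorem IsInteriorCover.exists_lebesgue_number (hU : c.IsInteriorCover U)
    (σ : c.SingularSimplex n) :
    ∃ δ > 0, ∀ t, ∃ j, σ.1 '' Metric.ball t δ ⊆ U j := by
  obtain ⟨δ, hδ, h⟩ := lebesgue_number_lemma_of_metric
    (c := fun j => interior (σ.1 ⁻¹' U j)) isCompact_univ (fun _ => isOpen_interior) (by
      intro t _
      obtain ⟨j, hj⟩ := hU.exists_isNhd (σ.1 t)
      refine Set.mem_iUnion.2 ⟨j, ?_⟩
      rw [← compl_compl (σ.1 ⁻¹' U j), interior_compl]
      intro ht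
      -- If `t` lay in the closure of the preimage of the complement of `U j`, continuity would put
      -- `σ.1 t` in the closure of that complement.
      refine hj rfl (c.cl_mono ?_ (σ.2 _ (Set.mem_image_of_mem σ.1 ht)))
      exact Set.image_preimage_subset σ.1 (U j)ᶜ)
  refine ⟨δ, hδ, fun t => ?_⟩
  obtain ⟨j, hj⟩ := h t (Set.mem_univ t)
  exact ⟨j, Set.image_subset_iff.2 (hj.trans interior_subset)⟩

theorem IsInteriorCover.exists_iterate_subdivision_mem (hU : c.IsInteriorCover U)
    (σ : c.SingularSimplex n) :
    ∃ k, (c.subdivision n ^ k) (Finsupp.single σ 1) ∈ c.smallChains U n := by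
  obtain ⟨δ, hδ, h⟩ := hU.exists_lebesgue_number σ
  obtain ⟨k, hk⟩ := exists_pow_lt_of_lt_one hδ
    (show (n : ℝ) / (n + 1) < 1 by rw [div_lt_one (by positivity)]; linarith)
  refine ⟨k, ?_⟩
  rw [← push_single_vertex, iterate_subdivision_push]
  refine Finsupp.map_mem_supported _ (fun w hw => ?_)
    (OrderedChain.iterate_subdivision_mem_supported n k)
  rw [push_single]
  obtain ⟨j, hj⟩ := h (w 0)
  refine Finsupp.single_mem_supported ℤ _ ⟨j, ?_⟩
  rintro _ ⟨t, rfl⟩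
  exact hj ⟨_, Metric.mem_ball.2 ((dist_affine_le (fun i => hw i 0) t).trans_lt hk), rfl⟩

end CechClosure

end

/-! ### A homotopy whose number of subdivisions depends on the simplex. -/

noncomputable section

namespace CechClosure

variable {X : Type u} {c : CechClosure X} {J : Type v} {U : J → Set X} {n : ℕ}

theorem iterate_subdivision_mem_smallChains {x : c.SingularChain n} {k l : ℕ} (hkl : k ≤ l)
    (hx : (c.subdivision n ^ k) x ∈ c.smallChains U n) :
    (c.subdivision n ^ l) x ∈ c.smallChains U n := by
  induction l, hkl using Nat.le_induction with
  | base => exact hx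
  | succ l _ ih =>
    rw [pow_succ', Module.End.mul_apply]
    exact subdivision_mem_smallChains ih

theorem boundary_iterate_subdivision (k : ℕ) (x : c.SingularChain (n + 1)) :
    c.boundary n ((c.subdivision (n + 1) ^ k) x) = (c.subdivision n ^ k) (c.boundary n x) := by
  induction k with
  | zero => rfl
  | succ k ih => rw [pow_succ', pow_succ', Module.End.mul_apply, Module.End.mul_apply,
      boundary_subdivision, ih]

variable (c) in
/-- The chain homotopy between `k`-fold barycentric subdivision and the identity. -/
def iterateHomotopy (n k : ℕ) : c.SingularChain n →ₗ[ℤ] c.SingularChain (n + 1) :=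
  ∑ i ∈ Finset.range k, c.subdivisionHomotopy n ∘ₗ c.subdivision n ^ i

theorem iterateHomotopy_succ_apply (k : ℕ) (x : c.SingularChain n) :
    c.iterateHomotopy n (k + 1) x =
      c.iterateHomotopy n k x + c.subdivisionHomotopy n ((c.subdivision n ^ k) x) := by
  simp [iterateHomotopy, Finset.sum_range_succ]

theorem boundary_iterateHomotopy (k : ℕ) (x : c.SingularChain (n + 1)) :
    c.boundary (n + 1) (c.iterateHomotopy (n + 1) k x) + c.iterateHomotopy n k (c.boundary n x) =
      x - (c.subdivision (n + 1) ^ k) x := by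
  induction k with
  | zero => simp [iterateHomotopy]
  | succ k ih =>
    have h := boundary_subdivisionHomotopy ((c.subdivision (n + 1) ^ k) x)
    rw [boundary_iterate_subdivision] at h
    rw [iterateHomotopy_succ_apply, iterateHomotopy_succ_apply, map_add, add_add_add_comm, ih, h,
      pow_succ', Module.End.mul_apply, sub_add_sub_cancel]

theorem boundary_iterateHomotopy_zero (k : ℕ) (x : c.SingularChain 0) :
    c.boundary 0 (c.iterateHomotopy 0 k x) = x - (c.subdivision 0 ^ k) x := by
  induction k with
  | zero => simp [iterateHomotopy]
  | succ k ih =>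
    rw [iterateHomotopy_succ_apply, map_add, ih, boundary_subdivisionHomotopy_zero,
      pow_succ', Module.End.mul_apply, sub_add_sub_cancel]

/-- The difference is the sum of T S^i x over k ≤ i < l, where S^i x is already small and T
preserves smallness. -/
theorem iterateHomotopy_sub_mem_smallChains {x : c.SingularChain n} {k l : ℕ} (hkl : k ≤ l)
    (hx : (c.subdivision n ^ k) x ∈ c.smallChains U n) :
    c.iterateHomotopy n l x - c.iterateHomotopy n k x ∈ c.smallChains U (n + 1) := by
  induction l, hkl using Nat.le_induction with
  | base => simp
  | succ l hl ih =>
    rw [iterateHomotopy_succ_apply, add_sub_right_comm]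
    exact add_mem ih
      (subdivisionHomotopy_mem_smallChains (iterate_subdivision_mem_smallChains hl hx))

variable (U) in
/-- The least number of subdivisions that turn a singular simplex into a small chain. -/
def subdivisionOrder (σ : c.SingularSimplex n) : ℕ :=
  sInf {k | (c.subdivision n ^ k) (Finsupp.single σ 1) ∈ c.smallChains U n}

/-- The interior cover makes the set of exponents nonempty, so the infimum is attained rather than
being the default 0. -/
theorem IsInteriorCover.iterate_subdivisionOrder_mem (hU : c.IsInteriorCover U)
    (σ : c.SingularSimplex n) :
    (c.subdivision n ^ subdivisionOrder U σ) (Finsupp.single σ 1) ∈ c.smallChains U n :=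
  Nat.sInf_mem (hU.exists_iterate_subdivision_mem σ)

theorem subdivisionOrder_eq_zero {σ : c.SingularSimplex n} (hσ : IsSmall U σ) :
    subdivisionOrder U σ = 0 :=
  Nat.sInf_eq_zero.2 (Or.inl (Finsupp.single_mem_supported ℤ _ hσ))

theorem IsSmall.face {σ : c.SingularSimplex (n + 1)} (hσ : IsSmall U σ) (i : Fin (n + 2)) :
    IsSmall U (σ.face i) := by
  obtain ⟨j, hj⟩ := hσ
  exact ⟨j, by rintro _ ⟨t, rfl⟩; exact hj ⟨_, rfl⟩⟩

variable (U) in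
/-- The maximum of `subdivisionOrder` over the iterated faces of a singular simplex. -/
def faceOrder : ∀ {n : ℕ}, c.SingularSimplex n → ℕ
  | 0, σ => subdivisionOrder U σ
  | _ + 1, σ => max (subdivisionOrder U σ) (Finset.univ.sup fun i => faceOrder (σ.face i))

theorem subdivisionOrder_le_faceOrder (σ : c.SingularSimplex n) :
    subdivisionOrder U σ ≤ faceOrder U σ := by
  cases n with
  | zero => rw [faceOrder]
  | succ n => rw [faceOrder]; exact le_max_left _ _

/-- This monotonicity is why the maximum over faces is taken: smallness of S^k σ as a chain directly
controls only the alternating sum S^k ∂σ, in which terms may cancel. -/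
theorem faceOrder_face_le (σ : c.SingularSimplex (n + 1)) (i : Fin (n + 2)) :
    faceOrder U (σ.face i) ≤ faceOrder U σ := by
  rw [faceOrder.eq_2 U n σ]
  exact le_max_of_le_right (Finset.le_sup (f := fun i => faceOrder U (σ.face i))
    (Finset.mem_univ i))

theorem faceOrder_eq_zero {σ : c.SingularSimplex n} (hσ : IsSmall U σ) : faceOrder U σ = 0 := by
  induction n with
  | zero => rw [faceOrder, subdivisionOrder_eq_zero hσ]
  | succ n ih =>
    rw [faceOrder, subdivisionOrder_eq_zero hσ, ← Nat.bot_eq_zero, max_eq_right bot_le]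
    exact (Finset.sup_congr rfl fun i _ => ih (hσ.face i)).trans (Finset.sup_bot _)

theorem IsInteriorCover.iterate_faceOrder_mem (hU : c.IsInteriorCover U)
    (σ : c.SingularSimplex n) :
    (c.subdivision n ^ faceOrder U σ) (Finsupp.single σ 1) ∈ c.smallChains U n :=
  iterate_subdivision_mem_smallChains (subdivisionOrder_le_faceOrder σ)
    (hU.iterate_subdivisionOrder_mem σ)

variable (c U) in
/-- The homotopy that subdivides every singular simplex until it and its faces are small. -/
def smallHomotopy (n : ℕ) : c.SingularChain n →ₗ[ℤ] c.SingularChain (n + 1) :=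
  Finsupp.linearCombination ℤ fun σ => c.iterateHomotopy n (faceOrder U σ) (Finsupp.single σ 1)

theorem smallHomotopy_single (σ : c.SingularSimplex n) :
    c.smallHomotopy U n (Finsupp.single σ 1) =
      c.iterateHomotopy n (faceOrder U σ) (Finsupp.single σ 1) := by
  simp [smallHomotopy]

/-- Small simplices are subdivided zero times; this makes the retraction a strict left inverse of
the inclusion. -/
theorem smallHomotopy_eq_zero {x : c.SingularChain n} (hx : x ∈ c.smallChains U n) :
    c.smallHomotopy U n x = 0 := by
  rw [smallHomotopy, Finsupp.linearCombination_apply]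
  refine Finset.sum_eq_zero fun σ hσ => ?_
  dsimp only
  rw [faceOrder_eq_zero (hx hσ)]
  simp [iterateHomotopy]

theorem IsInteriorCover.sub_smallHomotopy_mem (hU : c.IsInteriorCover U)
    (x : c.SingularChain (n + 1)) :
    x - (c.smallHomotopy U n (c.boundary n x) + c.boundary (n + 1) (c.smallHomotopy U (n + 1) x)) ∈
      c.smallChains U (n + 1) := by
  refine Finsupp.map_mem_supported (s := Set.univ) (LinearMap.id -
    (c.smallHomotopy U n ∘ₗ c.boundary n + c.boundary (n + 1) ∘ₗ c.smallHomotopy U (n + 1)))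
    (fun σ _ => ?_) (by simp)
  simp only [LinearMap.sub_apply, LinearMap.id_apply, LinearMap.add_apply, LinearMap.comp_apply,
    smallHomotopy_single]
  have h := boundary_iterateHomotopy (faceOrder U σ) (Finsupp.single σ 1)
  rw [← eq_sub_iff_add_eq] at h
  -- Here d = S^m σ and e - b = D_m ∂σ - D∂σ with m = `faceOrder U σ`; the latter is then compared
  -- face by face.
  rw [h, show ∀ a b d e : c.SingularChain (n + 1), a - (b + (a - d - e)) = d + (e - b) by
    intros; abel]
  refine add_mem (hU.iterate_faceOrder_mem σ) ?_
  simp only [boundary_single, map_sum, map_smul, smallHomotopy_single]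
  rw [← Finset.sum_sub_distrib]
  refine Submodule.sum_mem _ fun i _ => ?_
  rw [← smul_sub]
  exact Submodule.smul_mem _ _
    (iterateHomotopy_sub_mem_smallChains (faceOrder_face_le σ i) (hU.iterate_faceOrder_mem _))

theorem IsInteriorCover.sub_smallHomotopy_mem_zero (hU : c.IsInteriorCover U)
    (x : c.SingularChain 0) :
    x - c.boundary 0 (c.smallHomotopy U 0 x) ∈ c.smallChains U 0 := by
  refine Finsupp.map_mem_supported (s := Set.univ)
    (LinearMap.id - c.boundary 0 ∘ₗ c.smallHomotopy U 0) (fun σ _ => ?_) (by simp)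
  simp only [LinearMap.sub_apply, LinearMap.id_apply, LinearMap.comp_apply,
    smallHomotopy_single, boundary_iterateHomotopy_zero, sub_sub_cancel]
  exact hU.iterate_faceOrder_mem σ

/-! ### Assembling the chain homotopy equivalence. -/

open CategoryTheory

theorem singularChainComplex_d (n : ℕ) :
    c.singularChainComplex.d (n + 1) n = ModuleCat.ofHom (c.boundary n) :=
  ChainComplex.of_d (fun n => ModuleCat.of ℤ (c.SingularChain n))
    (fun n => ModuleCat.ofHom (c.boundary n)) n

variable (c U) in
/-- `smallHomotopy` as a morphism of modules. -/
def smallHomotopyHom (n : ℕ) : c.singularChainComplex.X n ⟶ c.singularChainComplex.X (n + 1) :=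
  ModuleCat.ofHom (c.smallHomotopy U n)

variable (c U) in
/-- The null-homotopic endomorphism `∂D + D∂` of the singular chain complex, for the homotopy
`D = smallHomotopy`. -/
def smallNullHomotopic : c.singularChainComplex ⟶ c.singularChainComplex :=
  Homotopy.nullHomotopicMap' fun i _ h =>
    c.smallHomotopyHom U i ≫ eqToHom (congrArg c.singularChainComplex.X h)

variable (c U) in
/-- The components of `smallNullHomotopic` as linear maps. -/
def smallNullHomotopicLinear (n : ℕ) : c.SingularChain n →ₗ[ℤ] c.SingularChain n :=
  ((c.smallNullHomotopic U).f n).hom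

theorem smallNullHomotopicLinear_zero (x : c.SingularChain 0) :
    c.smallNullHomotopicLinear U 0 x = c.boundary 0 (c.smallHomotopy U 0 x) := by
  have h : (c.smallNullHomotopic U).f 0 =
      c.smallHomotopyHom U 0 ≫ c.singularChainComplex.d 1 0 := by
    rw [smallNullHomotopic, Homotopy.nullHomotopicMap'_f_of_not_rel_left
      (show (ComplexShape.down ℕ).Rel 1 0 from rfl) (by simp), eqToHom_refl, Category.comp_id]
  rw [singularChainComplex_d] at h
  exact LinearMap.congr_fun (congrArg ModuleCat.Hom.hom h) x

theorem smallNullHomotopicLinear_succ (x : c.SingularChain (n + 1)) :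
    c.smallNullHomotopicLinear U (n + 1) x = c.smallHomotopy U n (c.boundary n x) +
      c.boundary (n + 1) (c.smallHomotopy U (n + 1) x) := by
  have h : (c.smallNullHomotopic U).f (n + 1) =
      c.singularChainComplex.d (n + 1) n ≫ c.smallHomotopyHom U n +
        c.smallHomotopyHom U (n + 1) ≫ c.singularChainComplex.d (n + 2) (n + 1) := by
    rw [smallNullHomotopic, Homotopy.nullHomotopicMap'_f
      (show (ComplexShape.down ℕ).Rel (n + 2) (n + 1) from rfl)
      (show (ComplexShape.down ℕ).Rel (n + 1) n from rfl), eqToHom_refl, Category.comp_id,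
      eqToHom_refl, Category.comp_id]
  rw [singularChainComplex_d, singularChainComplex_d] at h
  exact LinearMap.congr_fun (congrArg ModuleCat.Hom.hom h) x

/-- No computation is needed: a null-homotopic map is a chain map by construction. -/
theorem boundary_smallNullHomotopicLinear (x : c.SingularChain (n + 1)) :
    c.boundary n (c.smallNullHomotopicLinear U (n + 1) x) =
      c.smallNullHomotopicLinear U n (c.boundary n x) := by
  have h := (c.smallNullHomotopic U).comm (n + 1) n
  rw [singularChainComplex_d] at h
  exact LinearMap.congr_fun (congrArg ModuleCat.Hom.hom h) x

theorem smallNullHomotopicLinear_eq_zero {x : c.SingularChain n} (hx : x ∈ c.smallChains U n) :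
    c.smallNullHomotopicLinear U n x = 0 := by
  cases n with
  | zero => rw [smallNullHomotopicLinear_zero, smallHomotopy_eq_zero hx, map_zero]
  | succ n =>
    rw [smallNullHomotopicLinear_succ, smallHomotopy_eq_zero hx,
      smallHomotopy_eq_zero (boundary_mem_smallChains c U n x hx), map_zero, add_zero]

theorem IsInteriorCover.sub_smallNullHomotopicLinear_mem (hU : c.IsInteriorCover U)
    (x : c.SingularChain n) : x - c.smallNullHomotopicLinear U n x ∈ c.smallChains U n := by
  cases n with
  | zero =>
    rw [smallNullHomotopicLinear_zero]
    exact hU.sub_smallHomotopy_mem_zero x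
  | succ n =>
    rw [smallNullHomotopicLinear_succ]
    exact hU.sub_smallHomotopy_mem x

/-- The chain map `1 - (∂D + D∂)` from singular chains to small chains, for the homotopy
`D = smallHomotopy`. -/
def smallRetraction (hU : c.IsInteriorCover U) :
    c.singularChainComplex ⟶ c.smallSingularChainComplex U :=
  ChainComplex.ofHom
    (fun n => ModuleCat.ofHom (LinearMap.codRestrict (c.smallChains U n)
      (LinearMap.id - c.smallNullHomotopicLinear U n) hU.sub_smallNullHomotopicLinear_mem))
    (fun n => by
      simp only [smallSingularChainComplex, singularChainComplex, ChainComplex.of_d]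
      apply ModuleCat.hom_ext
      apply LinearMap.ext
      intro x
      refine Subtype.ext ?_
      change c.boundary n (x - c.smallNullHomotopicLinear U (n + 1) x) =
        c.boundary n x - c.smallNullHomotopicLinear U n (c.boundary n x)
      rw [map_sub, boundary_smallNullHomotopicLinear])

theorem smallInclusion_comp_smallRetraction (hU : c.IsInteriorCover U) :
    c.smallInclusion U ≫ smallRetraction hU = 𝟙 _ := by
  refine HomologicalComplex.Hom.ext (funext fun n => ModuleCat.hom_ext (LinearMap.ext fun x =>
    Subtype.ext ?_))
  obtain ⟨x, hx⟩ : c.smallChains U n := x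
  change x - c.smallNullHomotopicLinear U n x = x
  rw [smallNullHomotopicLinear_eq_zero hx, sub_zero]

theorem smallRetraction_comp_smallInclusion (hU : c.IsInteriorCover U) :
    smallRetraction hU ≫ c.smallInclusion U = 𝟙 _ - c.smallNullHomotopic U :=
  HomologicalComplex.Hom.ext (funext fun _ => ModuleCat.hom_ext (LinearMap.ext fun _ => rfl))

variable (c U) in
/-- The endomorphism `1 - (∂D + D∂)` is homotopic to the identity. -/
def homotopySubSmallNullHomotopic :
    Homotopy (𝟙 c.singularChainComplex - c.smallNullHomotopic U) (𝟙 _) :=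
  (Homotopy.equivSubZero.symm ((Homotopy.ofEq (sub_sub_cancel _ _)).trans
    (Homotopy.nullHomotopy' _))).symm

/-- The inclusion of small chains is a chain homotopy equivalence. -/
def smallHomotopyEquiv (hU : c.IsInteriorCover U) :
    HomotopyEquiv (c.smallSingularChainComplex U) c.singularChainComplex where
  hom := c.smallInclusion U
  inv := smallRetraction hU
  homotopyHomInvId := Homotopy.ofEq (smallInclusion_comp_smallRetraction hU)
  homotopyInvHomId := (Homotopy.ofEq (smallRetraction_comp_smallInclusion hU)).trans
    (c.homotopySubSmallNullHomotopic U)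

end CechClosure

end

theorem mainTheorem2 {X : Type u} (c : CechClosure X) {J : Type v} (U : J → Set X)
    (hU : c.IsInteriorCover U) :
    HomologicalComplex.homotopyEquivalences (ModuleCat.{u} ℤ) (ComplexShape.down ℕ)
        (c.smallInclusion U) ∧
      ∀ n : ℤ, CategoryTheory.IsIso (c.smallHomologyMap U n) := by
  refine ⟨⟨CechClosure.smallHomotopyEquiv hU, rfl⟩, fun n => ?_⟩
  have h : QuasiIso (c.smallInclusion U) :=
    inferInstanceAs (QuasiIso (CechClosure.smallHomotopyEquiv hU).hom)
  -- Extension by zero to negative degrees preserves quasi-isomorphisms, which gives all integer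
  -- degrees at once.
  have h' : QuasiIso (HomologicalComplex.extendMap (c.smallInclusion U) CechClosure.natToInt) :=
    (HomologicalComplex.quasiIso_extendMap_iff _ _).2 h
  exact inferInstanceAs (CategoryTheory.IsIso (HomologicalComplex.homologyMap
    (HomologicalComplex.extendMap (c.smallInclusion U) CechClosure.natToInt) n))
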